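/- **Theorem (number of edges of $\mathsf{DP}(n)$).** The degree partition of a simple graph on the vertex set $\{1,\dots,n\}$ is the vector in $\mathbb{R}^n$ obtained by rearranging its degree sequence in weakly decreasing order (zero entries are allowed). Let $\mathsf{DP}(n)\subset\mathbb{R}^n$ be the convex hull of all degree partitions of simple graphs on $\{1,\dots,n\}$. For every integer $n\ge 3$, the polytope $\mathsf{DP}(n)$ has exactly $2^{n-2}(2n-3)$ edges (one-dimensional faces). -/

import Mathlib

open Classical in
/-- The degree sequence of a simple graph on the vertex set `Fin n`. -/
noncomputable def degreeSequence {n : ℕ} (G : SimpleGraph (Fin n)) : Fin n → ℕ :=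
  fun i => G.degree i

/-- `d` is the degree partition of `G`: the rearrangement of the degree sequence of `G`
in weakly decreasing order. -/
def IsDegreePartition {n : ℕ} (G : SimpleGraph (Fin n)) (d : Fin n → ℕ) : Prop :=
  Antitone d ∧ ∃ σ : Equiv.Perm (Fin n), d = degreeSequence G ∘ σ

/-- The set of all degree partitions of simple graphs on `n` vertices. -/
def degreePartitions (n : ℕ) : Set (Fin n → ℕ) :=
  {d | ∃ G : SimpleGraph (Fin n), IsDegreePartition G d}

/-- The polytope of degree partitions: the convex hull in `ℝⁿ` of all degree partitions of
simple graphs on `n` vertices. -/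
def degreePartitionPolytope (n : ℕ) : Set (Fin n → ℝ) :=
  convexHull ℝ ((fun (d : Fin n → ℕ) (i : Fin n) => (d i : ℝ)) '' degreePartitions n)

/-- The edges of a polytope `P` in `ℝⁿ`: its faces (sets of maximizers over `P` of a linear
functional) of affine dimension one. The empty set has `vectorSpan` of rank zero, so it is
not counted. -/
def polytopeEdges {n : ℕ} (P : Set (Fin n → ℝ)) : Set (Set (Fin n → ℝ)) :=
  {F | IsExposed ℝ P F ∧ Module.finrank ℝ (vectorSpan ℝ F) = 1}

open Finset

/-! On antitone vectors a linear functional can be compared with its projection `a` onto the cone of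
antitone vectors. Threshold graphs built from `a` have degrees ordered like `a`, so they attain the
original maximum, and every point of the exposed face also maximizes `a` (`exists_exposing_weight`).
Maximizing `a` over degree vectors means maximizing the edge weights `a i + a j`: positive pairs are
forced in, negative pairs are forced out, and only ties `a i + a j = 0` are free.

Ties at different absolute values can be switched on independently. A one-dimensional face therefore
has exactly one tie level and is the segment from the degree vector with no tied edges to the one
with all of them (`eq_segment_of_mem_polytopeEdges`). Conversely, for antitone `a` with one tie
level, penalizing variation on the level sets of `a` exposes precisely that segment
(`segment_mem_polytopeEdges`).

It remains to count the endpoint pairs. The sign of the sum of the first and last weights says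
whether the first vertex dominates, the last is isolated, or the two are tied. Hence e(N) = 2 e(N-1)
+ o(N), where o(N) counts outermost ties (`ncard_thresholdPairs_succ`). An outermost tie is either
the zero weight vector or consists of p weights t > 0, q weights -t, and m tie-free inner weights,
which give 2^(m-1) possibilities (one if m = 0). Summing gives o(N) = 2^(N-1) for N ≥ 3, and e(2) =
1 starts the recursion. -/

open scoped Classical in
/-- The degree vector of a graph, with real entries. -/
noncomputable def realDegree {n : ℕ} (G : SimpleGraph (Fin n)) (i : Fin n) : ℝ :=
  ∑ j, if G.Adj i j then 1 else 0

/-- The graph joining two vertices when their weights have positive sum, or sum zero and common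
absolute value in `T`. -/
def tieGraph {n : ℕ} (a : Fin n → ℝ) (T : Set ℝ) : SimpleGraph (Fin n) where
  Adj i j := i ≠ j ∧ (0 < a i + a j ∨ (a i + a j = 0 ∧ |a i| ∈ T))
  symm := ⟨by
    rintro i j ⟨hij, h⟩
    refine ⟨hij.symm, ?_⟩
    rcases h with h | ⟨h, hT⟩
    · left; linarith
    · right
      refine ⟨by linarith, ?_⟩
      rwa [show a j = - a i by linarith, abs_neg]⟩
  loopless := ⟨fun i h => h.1 rfl⟩

/-- A graph that maximizes the sum of `a i + a j` over its edges `ij`. -/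
def IsMaxGraph {n : ℕ} (a : Fin n → ℝ) (G : SimpleGraph (Fin n)) : Prop :=
  ∀ i j, i ≠ j → (0 < a i + a j → G.Adj i j) ∧ (a i + a j < 0 → ¬ G.Adj i j)

/-- The weights `a` have ties, all of them at the same absolute value. -/
def HasUniqueTie {n : ℕ} (a : Fin n → ℝ) : Prop :=
  ∃ i j, i ≠ j ∧ a i + a j = 0 ∧ ∀ k l, k ≠ l → a k + a l = 0 → |a k| = |a i|

/-- The degree partitions with real entries. -/
def realDegreePartitions (n : ℕ) : Set (Fin n → ℝ) :=
  (fun (d : Fin n → ℕ) (i : Fin n) => (d i : ℝ)) '' degreePartitions n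

/-- The sum of the positive parts of `a i + a j` over ordered pairs of distinct indices, halved. -/
noncomputable def maxWeight {n : ℕ} (a : Fin n → ℝ) : ℝ :=
  (∑ p : Fin n × Fin n, if p.1 ≠ p.2 then max (a p.1 + a p.2) 0 else 0) / 2

variable {n : ℕ}

/-! ### Degree vectors and graphs of maximal weight -/

lemma realDegree_eq_degree (G : SimpleGraph (Fin n)) (i : Fin n) :
    realDegree G i = (degreeSequence G i : ℝ) := by
  classical
  unfold realDegree degreeSequence
  rw [Finset.sum_boole, ← SimpleGraph.card_neighborFinset_eq_degree,
    SimpleGraph.neighborFinset_eq_filter]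

lemma mem_realDegreePartitions {v : Fin n → ℝ} :
    v ∈ realDegreePartitions n ↔ Antitone v ∧ ∃ G, v = realDegree G := by
  classical
  constructor
  · rintro ⟨d, ⟨G, hd, σ, hσ⟩, rfl⟩
    refine ⟨fun i j h => Nat.cast_le.2 (hd h), G.comap σ, ?_⟩
    funext i
    simp only [hσ, Function.comp, ← realDegree_eq_degree, realDegree, SimpleGraph.comap_adj]
    exact (Equiv.sum_comp σ fun j => if G.Adj (σ i) j then (1 : ℝ) else 0).symm
  · rintro ⟨hv, G, rfl⟩
    refine ⟨degreeSequence G, ⟨G, fun i j h => ?_, 1, rfl⟩, ?_⟩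
    · have := hv h
      rw [realDegree_eq_degree, realDegree_eq_degree] at this
      exact_mod_cast this
    · funext i
      exact (realDegree_eq_degree G i).symm

lemma two_mul_sum_mul_realDegree (a : Fin n → ℝ) (G : SimpleGraph (Fin n))
    [DecidableRel G.Adj] :
    2 * ∑ i, a i * realDegree G i =
      ∑ p : Fin n × Fin n, if G.Adj p.1 p.2 then a p.1 + a p.2 else 0 := by
  have h1 : ∑ i, a i * realDegree G i = ∑ i, ∑ j, if G.Adj i j then a i else 0 := by
    refine Finset.sum_congr rfl fun i _ => ?_
    simp only [realDegree, Finset.mul_sum]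
    refine Finset.sum_congr rfl fun j _ => ?_
    split_ifs <;> simp
  have h2 : ∑ i, ∑ j, (if G.Adj i j then a i else 0) = ∑ i, ∑ j, if G.Adj i j then a j else 0 := by
    rw [Finset.sum_comm]
    simp only [G.adj_comm]
  rw [two_mul, Fintype.sum_prod_type]
  nth_rewrite 2 [h1]
  rw [h1]
  nth_rewrite 2 [h2]
  rw [← Finset.sum_add_distrib]
  refine Finset.sum_congr rfl fun i _ => ?_
  rw [← Finset.sum_add_distrib]
  refine Finset.sum_congr rfl fun j _ => ?_
  split_ifs <;> simp

lemma ite_adj_le (a : Fin n → ℝ) (G : SimpleGraph (Fin n)) [DecidableRel G.Adj]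
    (p : Fin n × Fin n) :
    (if G.Adj p.1 p.2 then a p.1 + a p.2 else 0) ≤
      if p.1 ≠ p.2 then max (a p.1 + a p.2) 0 else 0 := by
  by_cases h : G.Adj p.1 p.2
  · simp [h, h.ne]
  · rw [if_neg h]
    split_ifs <;> simp

lemma sum_mul_realDegree_le (a : Fin n → ℝ) (G : SimpleGraph (Fin n)) :
    ∑ i, a i * realDegree G i ≤ maxWeight a := by
  classical
  have := two_mul_sum_mul_realDegree a G
  have h2 := Finset.sum_le_sum fun p (_ : p ∈ Finset.univ) => ite_adj_le a G p
  unfold maxWeight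
  linarith

/-- Each pair contributes at most its positive part, so equality of the sums holds exactly when it
holds pair by pair; pairs of weight zero impose nothing. -/
lemma sum_mul_realDegree_eq_iff (a : Fin n → ℝ) (G : SimpleGraph (Fin n)) :
    ∑ i, a i * realDegree G i = maxWeight a ↔ IsMaxGraph a G := by
  classical
  have h1 := two_mul_sum_mul_realDegree a G
  have h2 := Finset.sum_eq_sum_iff_of_le fun p (_ : p ∈ Finset.univ) => ite_adj_le a G p
  have h3 : ∑ i, a i * realDegree G i = maxWeight a ↔
      (∑ p : Fin n × Fin n, if G.Adj p.1 p.2 then a p.1 + a p.2 else 0) =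
        ∑ p : Fin n × Fin n, if p.1 ≠ p.2 then max (a p.1 + a p.2) 0 else 0 := by
    unfold maxWeight
    constructor <;> intro h <;> linarith
  rw [h3, h2]
  constructor
  · intro h i j hij
    have := h (i, j) (Finset.mem_univ _)
    simp only [ne_eq, hij, not_false_eq_true, if_true] at this
    constructor
    · intro hp
      by_contra hn
      rw [if_neg hn, max_eq_left hp.le] at this
      linarith
    · intro hp hn
      rw [if_pos hn, max_eq_right hp.le] at this
      linarith
  · rintro h ⟨i, j⟩ -
    by_cases hij : i = j
    · simp [hij]
    · have := h i j hij
      simp only [ne_eq, hij, not_false_eq_true, if_true]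
      rcases lt_trichotomy (a i + a j) 0 with h0 | h0 | h0
      · rw [if_neg (this.2 h0), max_eq_right h0.le]
      · simp [h0]
      · rw [if_pos (this.1 h0), max_eq_left h0.le]

/-! ### Threshold graphs with prescribed ties -/

lemma isMaxGraph_tieGraph (a : Fin n → ℝ) (T : Set ℝ) : IsMaxGraph a (tieGraph a T) := by
  intro i j hij
  refine ⟨fun h => ⟨hij, Or.inl h⟩, ?_⟩
  rintro h ⟨-, h' | h'⟩ <;> linarith

/-- The transposition of `i` and `j` carries neighbours of `j` to neighbours of `i`: raising the
weight from `a j` to `a i` keeps a positive sum positive, and a tie either stays at the same level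
or becomes positive. -/
lemma realDegree_tieGraph_le (a : Fin n → ℝ) (T : Set ℝ) {i j : Fin n} (h : a j ≤ a i) :
    realDegree (tieGraph a T) j ≤ realDegree (tieGraph a T) i := by
  classical
  unfold realDegree
  rw [← Equiv.sum_comp (Equiv.swap i j)]
  refine Finset.sum_le_sum fun k _ => ?_
  have key : (tieGraph a T).Adj j (Equiv.swap i j k) → (tieGraph a T).Adj i k := by
    intro hk
    have mono : ∀ k, (tieGraph a T).Adj j k → k ≠ i → (tieGraph a T).Adj i k := by
      rintro k ⟨-, hk⟩ hki
      refine ⟨hki.symm, ?_⟩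
      rcases hk with hk | ⟨hk, hT⟩
      · left; linarith
      · rcases h.eq_or_lt with h | h
        · right; rw [← h]; exact ⟨hk, hT⟩
        · left; linarith
    by_cases hki : k = i
    · subst hki
      rw [Equiv.swap_apply_left] at hk
      exact absurd hk (SimpleGraph.irrefl _)
    · by_cases hkj : k = j
      · subst hkj
        rw [Equiv.swap_apply_right] at hk
        exact hk.symm
      · rw [Equiv.swap_apply_of_ne_of_ne hki hkj] at hk
        exact mono k hk hki
  split_ifs with h1 h2 h2
  · exact le_rfl
  · exact absurd (key h1) h2
  · exact zero_le_one
  · exact le_rfl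

lemma realDegree_tieGraph_mem {a : Fin n → ℝ} (ha : Antitone a) (T : Set ℝ) :
    realDegree (tieGraph a T) ∈ realDegreePartitions n :=
  mem_realDegreePartitions.2 ⟨fun _ _ h => realDegree_tieGraph_le a T (ha h), _, rfl⟩

lemma realDegree_mono {G H : SimpleGraph (Fin n)} {i : Fin n}
    (h : ∀ j, G.Adj i j → H.Adj i j) : realDegree G i ≤ realDegree H i := by
  classical
  refine Finset.sum_le_sum fun j _ => ?_
  by_cases hj : G.Adj i j
  · simp [hj, h j hj]
  · rw [if_neg hj]; split_ifs <;> simp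

lemma realDegree_lt {G H : SimpleGraph (Fin n)} {i j : Fin n}
    (h : ∀ j, G.Adj i j → H.Adj i j) (hG : ¬ G.Adj i j) (hH : H.Adj i j) :
    realDegree G i < realDegree H i := by
  classical
  refine Finset.sum_lt_sum (fun j _ => ?_) ⟨j, Finset.mem_univ _, by simp [hG, hH]⟩
  by_cases hj : G.Adj i j
  · simp [hj, h j hj]
  · rw [if_neg hj]; split_ifs <;> simp

lemma realDegree_congr {G H : SimpleGraph (Fin n)} {i : Fin n}
    (h : ∀ j, G.Adj i j ↔ H.Adj i j) : realDegree G i = realDegree H i :=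
  le_antisymm (realDegree_mono fun j => (h j).1) (realDegree_mono fun j => (h j).2)

lemma IsMaxGraph.mem_Icc {a : Fin n → ℝ} {G : SimpleGraph (Fin n)} (h : IsMaxGraph a G) :
    realDegree G ∈ Set.Icc (realDegree (tieGraph a ∅)) (realDegree (tieGraph a Set.univ)) := by
  constructor <;> intro i <;> apply realDegree_mono <;> intro j hj
  · rcases hj with ⟨hij, hj | hj⟩
    · exact (h i j hij).1 hj
    · exact absurd hj.2 (by simp)
  · refine ⟨hj.ne, ?_⟩
    rcases lt_trichotomy (a i + a j) 0 with h0 | h0 | h0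
    · exact absurd hj ((h i j hj.ne).2 h0)
    · exact Or.inr ⟨h0, trivial⟩
    · exact Or.inl h0

lemma realDegree_tie_lt {a : Fin n → ℝ} {i j : Fin n} (hij : i ≠ j) (h : a i + a j = 0)
    {T : Set ℝ} (hT : |a i| ∈ T) :
    realDegree (tieGraph a ∅) i < realDegree (tieGraph a T) i := by
  refine realDegree_lt (j := j) ?_ ?_ ⟨hij, Or.inr ⟨h, hT⟩⟩
  · rintro k ⟨hk, hk' | hk'⟩
    · exact ⟨hk, Or.inl hk'⟩
    · exact absurd hk'.2 (by simp)
  · rintro ⟨-, h' | h'⟩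
    · linarith
    · exact absurd h'.2 (by simp)

/-! ### Exposed faces and their antitone weights -/

/-- Projection to the cone of antitone vectors. -/
lemma exists_antitone_projection (c : Fin n → ℝ) :
    ∃ a : Fin n → ℝ, Antitone a ∧ (∀ x : Fin n → ℝ, Antitone x → 0 ≤ ∑ i, (a i - c i) * x i) ∧
      ∀ x : Fin n → ℝ, (∀ i j, a j ≤ a i → x j ≤ x i) → ∑ i, (a i - c i) * x i ≤ 0 := by
  let K : Set (EuclideanSpace ℝ (Fin n)) := {z | Antitone fun i => z i}
  have hne : K.Nonempty := ⟨0, fun i j _ => by simp⟩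
  have hclosed : IsClosed K := by
    have : K = ⋂ i, ⋂ j, ⋂ (_ : i ≤ j), {z : EuclideanSpace ℝ (Fin n) | z j ≤ z i} := by
      ext z
      simp only [Set.mem_iInter, Set.mem_ofPred_eq, K, Antitone]
    rw [this]
    refine isClosed_iInter fun i => isClosed_iInter fun j => isClosed_iInter fun _ => ?_
    exact isClosed_le (by fun_prop) (by fun_prop)
  have hconv : Convex ℝ K := by
    intro x hx y hy s t hs ht _ i j hij
    simp only [PiLp.add_apply, PiLp.smul_apply, smul_eq_mul]
    have h1 := mul_le_mul_of_nonneg_left (hx hij) hs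
    have h2 := mul_le_mul_of_nonneg_left (hy hij) ht
    simp only at h1 h2
    linarith
  obtain ⟨v, hvK, hv⟩ := exists_norm_eq_iInf_of_complete_convex hne hclosed.isComplete hconv
    (WithLp.toLp 2 c)
  rw [norm_eq_iInf_iff_real_inner_le_zero hconv hvK] at hv
  have key : ∀ z : Fin n → ℝ, Antitone (fun i => v i + z i) → 0 ≤ ∑ i, (v i - c i) * z i := by
    intro z hz
    have := hv (WithLp.toLp 2 fun i => v i + z i) hz
    simp only [PiLp.inner_apply, PiLp.sub_apply, RCLike.inner_apply, conj_trivial,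
      add_sub_cancel_left] at this
    rw [← neg_nonpos, ← Finset.sum_neg_distrib]
    refine le_trans (le_of_eq (Finset.sum_congr rfl fun i _ => ?_)) this
    ring
  refine ⟨fun i => v i, hvK, fun x hx => key x fun i j h => add_le_add (hvK h) (hx h), ?_⟩
  intro x hx
  -- Where `v i = v j`, the order condition forces `x i = x j`; where `v j < v i`, a small `ε`
  -- preserves the inequality. Thus `v - ε x` is an admissible competitor of the projection `v`.
  have hev : ∀ᶠ ε : ℝ in nhdsWithin 0 (Set.Ioi 0), ∀ i j : Fin n, i ≤ j →
      v j - ε * x j ≤ v i - ε * x i := by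
    refine Filter.eventually_all.2 fun i => Filter.eventually_all.2 fun j => ?_
    by_cases hij : i ≤ j
    · rcases (hvK hij : v j ≤ v i).eq_or_lt with h | h
      · have : x i = x j := le_antisymm (hx _ _ h.ge) (hx _ _ h.le)
        simp [h, this]
      · have hc : Filter.Tendsto (fun ε : ℝ => (v i - ε * x i) - (v j - ε * x j))
            (nhdsWithin 0 (Set.Ioi 0)) (nhds ((v i - 0 * x i) - (v j - 0 * x j))) := by
          refine Filter.Tendsto.mono_left (Continuous.tendsto (by fun_prop) 0) nhdsWithin_le_nhds
        filter_upwards [hc.eventually (lt_mem_nhds (show (0 : ℝ) < _ by linarith))] with ε hε _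
        linarith
    · simp [hij]
  obtain ⟨ε, hε, hε0⟩ := (hev.and self_mem_nhdsWithin).exists
  have h := key (fun i => -(ε * x i)) fun i j hij => by
    have := hε i j hij
    simp only
    linarith
  have h2 : ∑ i, (v i - c i) * -(ε * x i) = -(ε * ∑ i, (v i - c i) * x i) := by
    rw [Finset.mul_sum, ← Finset.sum_neg_distrib]
    exact Finset.sum_congr rfl fun i _ => by ring
  rw [h2] at h
  have hε0 : 0 < ε := hε0
  by_contra hcon
  push Not at hcon
  nlinarith [mul_pos hε0 hcon]

lemma mem_convexHull_maximizers {E : Type*} [AddCommGroup E] [Module ℝ E] {V : Set E}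
    (l : E →ₗ[ℝ] ℝ) {M : ℝ} (hM : ∀ v ∈ V, l v ≤ M) {x : E} (hx : x ∈ convexHull ℝ V)
    (hl : l x = M) : x ∈ convexHull ℝ {v ∈ V | l v = M} := by
  -- A combination with positive coefficients reaches level `M` only if both points do, which makes
  -- this condition convex.
  let C : Set E := {x | l x ≤ M ∧ (l x = M → x ∈ convexHull ℝ {v ∈ V | l v = M})}
  have hC : Convex ℝ C := by
    intro x hx y hy s t hs ht hst
    have hl : l (s • x + t • y) = s * l x + t * l y := by simp
    have hxM := mul_le_mul_of_nonneg_left hx.1 hs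
    have hyM := mul_le_mul_of_nonneg_left hy.1 ht
    have hMM : s * M + t * M = M := by rw [← add_mul, hst, one_mul]
    refine ⟨by linarith, fun h => ?_⟩
    rcases hs.eq_or_lt with rfl | hs'
    · have : t = 1 := by linarith
      subst this
      simpa using hy.2 (by simpa using h)
    rcases ht.eq_or_lt with rfl | ht'
    · have : s = 1 := by linarith
      subst this
      simpa using hx.2 (by simpa using h)
    refine convex_convexHull ℝ _ (hx.2 (le_antisymm hx.1 ?_)) (hy.2 (le_antisymm hy.1 ?_)) hs ht hst
    · by_contra hlt
      push Not at hlt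
      nlinarith [mul_lt_mul_of_pos_left hlt hs']
    · by_contra hlt
      push Not at hlt
      nlinarith [mul_lt_mul_of_pos_left hlt ht']
  have : convexHull ℝ V ⊆ C :=
    convexHull_min (fun v hv => ⟨hM v hv, fun h => subset_convexHull ℝ _ ⟨hv, h⟩⟩) hC
  exact (this hx).2 hl

lemma sum_mul_le_maxWeight (a : Fin n → ℝ) {v : Fin n → ℝ} (hv : v ∈ realDegreePartitions n) :
    ∑ i, a i * v i ≤ maxWeight a := by
  obtain ⟨-, G, rfl⟩ := mem_realDegreePartitions.1 hv
  exact sum_mul_realDegree_le a G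

lemma sum_mul_tieGraph (a : Fin n → ℝ) (T : Set ℝ) :
    ∑ i, a i * realDegree (tieGraph a T) i = maxWeight a :=
  (sum_mul_realDegree_eq_iff a _).2 (isMaxGraph_tieGraph a T)

/-- The linear functional with given coefficients. -/
noncomputable def coeffFunctional (c : Fin n → ℝ) : (Fin n → ℝ) →ₗ[ℝ] ℝ :=
  Fintype.linearCombination ℝ c

lemma coeffFunctional_apply (c x : Fin n → ℝ) : coeffFunctional c x = ∑ i, c i * x i := by
  simp [coeffFunctional, Fintype.linearCombination_apply, mul_comm]

lemma antitone_of_mem_polytope {x : Fin n → ℝ} (hx : x ∈ degreePartitionPolytope n) :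
    Antitone x := by
  refine convexHull_min (t := {x | Antitone x}) (fun v hv => (mem_realDegreePartitions.1 hv).1) ?_ hx
  intro x hx y hy s t hs ht _ i j hij
  exact add_le_add (mul_le_mul_of_nonneg_left (hx hij) hs) (mul_le_mul_of_nonneg_left (hy hij) ht)

lemma sum_mul_le_of_mem_polytope (a : Fin n → ℝ) {x : Fin n → ℝ}
    (hx : x ∈ degreePartitionPolytope n) : ∑ i, a i * x i ≤ maxWeight a := by
  refine convexHull_min (t := {x | coeffFunctional a x ≤ maxWeight a}) (fun v hv => ?_)
    (convex_halfSpace_le (coeffFunctional a).isLinear _) hx |>.trans' (coeffFunctional_apply a x).ge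
  exact (coeffFunctional_apply a v).le.trans (sum_mul_le_maxWeight a hv)

lemma exists_exposing_weight {F : Set (Fin n → ℝ)} (hF : IsExposed ℝ (degreePartitionPolytope n) F)
    (hne : F.Nonempty) :
    ∃ a : Fin n → ℝ, Antitone a ∧ (∀ T, realDegree (tieGraph a T) ∈ F) ∧
      ∀ x ∈ F, x ∈ degreePartitionPolytope n ∧ ∑ i, a i * x i = maxWeight a := by
  obtain ⟨l, rfl⟩ := hF hne
  obtain ⟨a, ha, hpos, hneg⟩ := exists_antitone_projection fun i => l (Pi.single i 1)
  have hl : ∀ x, l x = ∑ i, a i * x i - ∑ i, (a i - l (Pi.single i 1)) * x i := by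
    intro x
    rw [← Finset.sum_sub_distrib]
    have : l x = ∑ i, x i • l (Pi.single i 1) := by
      conv_lhs => rw [← Finset.univ_sum_single x, map_sum]
      refine Finset.sum_congr rfl fun i _ => ?_
      rw [← map_smul, ← Pi.single_smul, smul_eq_mul, mul_one]
    rw [this]
    refine Finset.sum_congr rfl fun i _ => ?_
    rw [smul_eq_mul]; ring
  have hle : ∀ x ∈ degreePartitionPolytope n, l x ≤ maxWeight a := by
    intro x hx
    have h1 := sum_mul_le_of_mem_polytope a hx
    have h2 := hpos x (antitone_of_mem_polytope hx)
    rw [hl]; linarith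
  -- The second half of the projection property applies because the degrees are ordered like `a`; it
  -- turns the upper bound into an attained maximum.
  have hT : ∀ T, l (realDegree (tieGraph a T)) = maxWeight a := by
    intro T
    refine le_antisymm (hle _ (subset_convexHull ℝ _ (realDegree_tieGraph_mem ha T))) ?_
    have := hneg _ fun i j => realDegree_tieGraph_le a T
    rw [hl, sum_mul_tieGraph]
    linarith
  refine ⟨a, ha, fun T => ⟨subset_convexHull ℝ _ (realDegree_tieGraph_mem ha T), ?_⟩, ?_⟩
  · intro y hy
    rw [hT]
    exact hle y hy
  · rintro x ⟨hx, hmax⟩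
    refine ⟨hx, le_antisymm (sum_mul_le_of_mem_polytope a hx) ?_⟩
    have h1 := hmax _ (subset_convexHull ℝ _ (realDegree_tieGraph_mem ha ∅))
    have h2 := hpos x (antitone_of_mem_polytope hx)
    rw [hT, hl] at h1
    linarith

/-- A maximizer in the hull is a convex combination of maximizing degree vectors, each coming from a
maximal graph and hence lying in this box. -/
lemma mem_Icc_of_sum_mul_eq {a x : Fin n → ℝ} (hx : x ∈ degreePartitionPolytope n)
    (h : ∑ i, a i * x i = maxWeight a) :
    x ∈ Set.Icc (realDegree (tieGraph a ∅)) (realDegree (tieGraph a Set.univ)) := by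
  have h1 := mem_convexHull_maximizers (coeffFunctional a)
    (fun v hv => (coeffFunctional_apply a v).le.trans (sum_mul_le_maxWeight a hv)) hx
    ((coeffFunctional_apply a x).trans h)
  refine convexHull_min ?_ (convex_Icc _ _) h1
  rintro v ⟨hv, hav⟩
  obtain ⟨-, G, rfl⟩ := mem_realDegreePartitions.1 hv
  rw [coeffFunctional_apply, sum_mul_realDegree_eq_iff] at hav
  exact hav.mem_Icc

lemma tieGraph_congr_of_no_tie {a : Fin n → ℝ} {i : Fin n} (T S : Set ℝ)
    (h : ∀ j, i ≠ j → a i + a j = 0 → (|a i| ∈ T ↔ |a i| ∈ S)) :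
    realDegree (tieGraph a T) i = realDegree (tieGraph a S) i := by
  refine realDegree_congr fun j => ?_
  refine and_congr_right fun hij => or_congr_right ?_
  exact and_congr_right fun h0 => h j hij h0

lemma eq_segment_of_mem_polytopeEdges {F : Set (Fin n → ℝ)}
    (hF : F ∈ polytopeEdges (degreePartitionPolytope n)) :
    ∃ a : Fin n → ℝ, Antitone a ∧ HasUniqueTie a ∧
      F = segment ℝ (realDegree (tieGraph a ∅)) (realDegree (tieGraph a Set.univ)) := by
  obtain ⟨hexp, hrank⟩ := hF
  have hne : F.Nonempty := by
    by_contra h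
    rw [Set.not_nonempty_iff_eq_empty] at h
    rw [h, vectorSpan_empty, finrank_bot] at hrank
    exact zero_ne_one hrank
  obtain ⟨a, ha, hmem, hmax⟩ := exists_exposing_weight hexp hne
  have hIcc : ∀ x ∈ F, x ∈ Set.Icc (realDegree (tieGraph a ∅)) (realDegree (tieGraph a Set.univ)) :=
    fun x hx => mem_Icc_of_sum_mul_eq (hmax x hx).1 (hmax x hx).2
  have htie : ∃ i j, i ≠ j ∧ a i + a j = 0 := by
    by_contra! hno
    have heq : realDegree (tieGraph a ∅) = realDegree (tieGraph a Set.univ) :=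
      funext fun i => tieGraph_congr_of_no_tie _ _ fun j hij h => absurd h (hno i j hij)
    have : F ⊆ {realDegree (tieGraph a ∅)} := by
      intro x hx
      have := hIcc x hx
      rw [← heq, Set.Icc_self] at this
      exact this
    have hs := (Set.subset_singleton_iff_eq.1 this).resolve_left hne.ne_empty
    rw [hs, vectorSpan_singleton, finrank_bot] at hrank
    exact zero_ne_one hrank
  obtain ⟨i, j, hij, h0⟩ := htie
  obtain ⟨v, hv⟩ := (collinear_iff_of_mem (hmem ∅)).1
    (collinear_iff_finrank_le_one.2 hrank.le)
  obtain ⟨r, hr⟩ := hv _ (hmem Set.univ)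
  -- This test point switches on only the ties at level `|a i|`. It agrees at `i` with the all-ties
  -- point, so on a line the two coincide; a tie at another level would separate them.
  obtain ⟨r', hr'⟩ := hv _ (hmem {|a i|})
  have hlt := realDegree_tie_lt hij h0 (Set.mem_univ |a i|)
  have heq : realDegree (tieGraph a Set.univ) i = realDegree (tieGraph a {|a i|}) i :=
    tieGraph_congr_of_no_tie _ _ fun j _ _ => by simp
  have hri := congrFun hr i
  have hri' := congrFun hr' i
  simp only [vadd_eq_add, Pi.add_apply, Pi.smul_apply, smul_eq_mul] at hri hri'
  have hrv : 0 < r * v i := by linarith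
  have hvi : v i ≠ 0 := by rintro h; simp [h] at hrv
  have hrr : r = r' := mul_right_cancel₀ hvi (by linarith)
  refine ⟨a, ha, ⟨i, j, hij, h0, ?_⟩, ?_⟩
  · intro k l hkl hk
    by_contra hne
    have h1 := realDegree_tie_lt hkl hk (Set.mem_univ |a k|)
    have h2 : realDegree (tieGraph a ∅) k = realDegree (tieGraph a {|a i|}) k :=
      tieGraph_congr_of_no_tie _ _ fun j _ _ => by simpa using hne
    rw [hr, hrr, ← hr', h2] at h1
    exact lt_irrefl _ h1
  · apply Set.Subset.antisymm
    · intro x hx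
      obtain ⟨s, hs⟩ := hv x hx
      have hsi := congrFun hs i
      simp only [vadd_eq_add, Pi.add_apply, Pi.smul_apply, smul_eq_mul] at hsi
      have hx1 := (hIcc x hx).1 i
      have hx2 := (hIcc x hx).2 i
      have hdiv : s / r = (s * v i) / (r * v i) := (mul_div_mul_right _ _ hvi).symm
      have hr0 : r ≠ 0 := by rintro rfl; simp at hrv
      rw [segment_eq_image']
      refine ⟨s / r, ⟨?_, ?_⟩, ?_⟩
      · rw [hdiv]; exact div_nonneg (by linarith) hrv.le
      · rw [hdiv, div_le_one hrv]; linarith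
      · simp only
        rw [hs, hr, vadd_eq_add, vadd_eq_add, add_sub_cancel_right, smul_smul,
          div_mul_cancel₀ _ hr0, add_comm]
    · exact (hexp.convex (convex_convexHull ℝ _)).segment_subset (hmem _) (hmem _)

/-! ### Exposing the segment of a unique tie level -/

/-- Only the values of `w` on the blocks `a = t` and `a = -t` are free, and orthogonality to `a`
links them, so one vanishing value forces the other. For `t = 0` the blocks coincide. -/
lemma eq_zero_of_sum_mul_eq_zero {a w : Fin n → ℝ} {t : ℝ}
    (hblock : ∀ i j, a i = a j → w i = w j) (hsupp : ∀ i, |a i| ≠ t → w i = 0)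
    (hsum : ∑ i, a i * w i = 0) {i : Fin n} (hi : |a i| = t) (hwi : w i = 0) : w = 0 := by
  funext k
  by_contra hk
  have hak : a k = - a i := by
    have h1 : |a k| = |a i| := by
      rw [hi]; by_contra h; exact hk (hsupp k h)
    rcases abs_eq_abs.1 h1 with h | h
    · exact absurd ((hblock k i h).trans hwi) hk
    · exact h
  have hne : a i ≠ 0 := by
    intro h
    exact hk ((hblock k i (by rw [hak, h, neg_zero])).trans hwi)
  -- The block of `i` contributes nothing, so the sum is the size of the block of `k` times `a k * w
  -- k`.
  have hterm : ∀ j, a j * w j = if a j = a k then a k * w k else 0 := by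
    intro j
    split_ifs with h
    · rw [h, hblock j k h]
    · by_cases hj : |a j| = |a i|
      · rcases abs_eq_abs.1 hj with h' | h'
        · rw [hblock j i h', hwi]; simp
        · exact absurd (h'.trans hak.symm) h
      · rw [hsupp j (by rw [← hi]; exact hj)]; simp
  rw [Finset.sum_congr rfl fun j _ => hterm j] at hsum
  rw [Finset.sum_ite, Finset.sum_const_zero, add_zero, Finset.sum_const, smul_eq_zero] at hsum
  rcases hsum with h | h
  · have : k ∈ Finset.univ.filter fun j => a j = a k := by simp
    rw [Finset.card_eq_zero] at h
    simp [h] at this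
  · rcases mul_eq_zero.1 h with h | h
    · exact hne (by linarith)
    · exact hk h

/-- The sum of the differences `x i - x j` over pairs `i < j` with `a i = a j`. -/
noncomputable def blockFunctional (a : Fin n → ℝ) : (Fin n → ℝ) →ₗ[ℝ] ℝ :=
  ∑ p : Fin n × Fin n, if p.1 < p.2 ∧ a p.1 = a p.2 then
    LinearMap.proj (R := ℝ) (φ := fun _ => ℝ) p.1 - LinearMap.proj p.2 else 0

lemma blockFunctional_apply (a x : Fin n → ℝ) : blockFunctional a x =
    ∑ p : Fin n × Fin n, if p.1 < p.2 ∧ a p.1 = a p.2 then x p.1 - x p.2 else 0 := by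
  simp only [blockFunctional, LinearMap.sum_apply]
  refine Finset.sum_congr rfl fun p _ => ?_
  split_ifs <;> simp

lemma blockFunctional_nonneg (a : Fin n → ℝ) {x : Fin n → ℝ} (hx : Antitone x) :
    0 ≤ blockFunctional a x := by
  rw [blockFunctional_apply]
  refine Finset.sum_nonneg fun p _ => ?_
  split_ifs with h
  · linarith [hx h.1.le]
  · exact le_rfl

lemma blockFunctional_eq_zero_iff (a : Fin n → ℝ) {x : Fin n → ℝ} (hx : Antitone x) :
    blockFunctional a x = 0 ↔ ∀ i j, a i = a j → x i = x j := by
  rw [blockFunctional_apply, Finset.sum_eq_zero_iff_of_nonneg]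
  · constructor
    · intro h
      have key : ∀ i j, i < j → a i = a j → x i = x j := by
        intro i j hij ha
        have := h (i, j) (Finset.mem_univ _)
        rw [if_pos ⟨hij, ha⟩] at this
        exact sub_eq_zero.1 this
      intro i j ha
      rcases lt_trichotomy i j with h | rfl | h
      · exact key i j h ha
      · rfl
      · exact (key j i h ha.symm).symm
    · intro h p _
      split_ifs with hp
      · rw [h _ _ hp.2, sub_self]
      · rfl
  · intro p _
    split_ifs with h
    · linarith [hx h.1.le]
    · exact le_rfl

lemma finrank_vectorSpan_segment {E : Type*} [AddCommGroup E] [Module ℝ E] {x y : E}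
    (h : x ≠ y) : Module.finrank ℝ (vectorSpan ℝ (segment ℝ x y)) = 1 := by
  rw [← convexHull_pair, ← direction_affineSpan, affineSpan_convexHull, direction_affineSpan,
    vectorSpan_pair]
  exact finrank_span_singleton (by simpa [sub_eq_zero] using h)

lemma mem_segment_of_block_const {a v : Fin n → ℝ} (hu : HasUniqueTie a)
    (hv : v ∈ Set.Icc (realDegree (tieGraph a ∅)) (realDegree (tieGraph a Set.univ)))
    (hblock : ∀ i j, a i = a j → v i = v j) (hsum : ∑ i, a i * v i = maxWeight a) :
    v ∈ segment ℝ (realDegree (tieGraph a ∅)) (realDegree (tieGraph a Set.univ)) := by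
  obtain ⟨i, j, hij, h0, huniq⟩ := hu
  set x := realDegree (tieGraph a ∅) with hx
  set y := realDegree (tieGraph a Set.univ) with hy
  have hlt : x i < y i := realDegree_tie_lt hij h0 (Set.mem_univ _)
  -- This parameter matches the coordinate `i`; block constancy and orthogonality to `a` then match
  -- all the others.
  set θ := (v i - x i) / (y i - x i) with hθ
  have hθi : θ * (y i - x i) = v i - x i := div_mul_cancel₀ _ (by linarith)
  have hz : v - x - θ • (y - x) = 0 := by
    refine eq_zero_of_sum_mul_eq_zero (a := a) (t := |a i|) ?_ ?_ ?_ rfl ?_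
    · intro k l hkl
      have h1 : x k = x l := le_antisymm (realDegree_tieGraph_le a _ hkl.le)
        (realDegree_tieGraph_le a _ hkl.ge)
      have h2 : y k = y l := le_antisymm (realDegree_tieGraph_le a _ hkl.le)
        (realDegree_tieGraph_le a _ hkl.ge)
      simp [h1, h2, hblock k l hkl]
    · intro k hk
      have h1 : x k = y k := tieGraph_congr_of_no_tie _ _ fun l hkl h =>
        absurd (huniq k l hkl h) hk
      have h2 : v k = x k := le_antisymm ((hv.2 k).trans h1.ge) (hv.1 k)
      simp [h1, h2]
    · have e : ∀ k, a k * (v - x - θ • (y - x)) k =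
          a k * v k - a k * x k - θ * (a k * y k - a k * x k) := by
        intro k
        simp only [Pi.sub_apply, Pi.smul_apply, smul_eq_mul]; ring
      simp only [e, Finset.sum_sub_distrib, ← Finset.mul_sum]
      rw [hsum, sum_mul_tieGraph, sum_mul_tieGraph]
      ring
    · simp only [Pi.sub_apply, Pi.smul_apply, smul_eq_mul]
      rw [hθi, sub_self]
  rw [segment_eq_image']
  refine ⟨θ, ⟨div_nonneg (by linarith [hv.1 i]) (by linarith), ?_⟩, ?_⟩
  · rw [hθ, div_le_one (by linarith)]
    linarith [hv.2 i]
  · simp only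
    rw [← sub_eq_zero, ← neg_eq_zero, ← hz]
    abel

lemma segment_mem_polytopeEdges {a : Fin n → ℝ} (ha : Antitone a) (hu : HasUniqueTie a) :
    segment ℝ (realDegree (tieGraph a ∅)) (realDegree (tieGraph a Set.univ)) ∈
      polytopeEdges (degreePartitionPolytope n) := by
  have hne : realDegree (tieGraph a ∅) ≠ realDegree (tieGraph a Set.univ) := by
    obtain ⟨i, j, hij, h0, -⟩ := hu
    intro h
    exact (realDegree_tie_lt hij h0 (Set.mem_univ |a i|)).ne (congrFun h i)
  refine ⟨fun _ => ?_, finrank_vectorSpan_segment hne⟩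
  -- The penalty discards maximizers of `a` that are not constant on its level sets, at no cost to
  -- the threshold graphs.
  set l : (Fin n → ℝ) →ₗ[ℝ] ℝ := coeffFunctional a - blockFunctional a with hl
  have hlx : ∀ x, l x = ∑ i, a i * x i - blockFunctional a x := fun x => by
    rw [hl, LinearMap.sub_apply, coeffFunctional_apply]
  have hle : ∀ x ∈ degreePartitionPolytope n, l x ≤ maxWeight a := fun x hx => by
    rw [hlx]
    linarith [sum_mul_le_of_mem_polytope a hx,
      blockFunctional_nonneg a (antitone_of_mem_polytope hx)]
  have hT : ∀ T, realDegree (tieGraph a T) ∈ degreePartitionPolytope n := fun T =>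
    subset_convexHull ℝ _ (realDegree_tieGraph_mem ha T)
  have hlT : ∀ T, l (realDegree (tieGraph a T)) = maxWeight a := fun T => by
    rw [hlx, sum_mul_tieGraph, (blockFunctional_eq_zero_iff a (antitone_of_mem_polytope (hT T))).2,
      sub_zero]
    intro i j h
    exact le_antisymm (realDegree_tieGraph_le a T h.le) (realDegree_tieGraph_le a T h.ge)
  refine ⟨LinearMap.toContinuousLinearMap l, Set.Subset.antisymm ?_ ?_⟩
  · intro x hx
    have hxP : x ∈ degreePartitionPolytope n :=
      (convex_convexHull ℝ _).segment_subset (hT _) (hT _) hx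
    refine ⟨hxP, fun y hy => ?_⟩
    have : l x = maxWeight a := by
      obtain ⟨s, t, -, -, hst, rfl⟩ := hx
      rw [map_add, map_smul, map_smul, hlT, hlT, ← add_smul, hst, one_smul]
    change l y ≤ l x
    rw [this]
    exact hle y hy
  · rintro x ⟨hxP, hmax⟩
    have hlxM : l x = maxWeight a :=
      le_antisymm (hle x hxP) ((hlT ∅).ge.trans (hmax _ (hT ∅)))
    have hV : ∀ v ∈ realDegreePartitions n, l v ≤ maxWeight a := fun v hv =>
      hle v (subset_convexHull ℝ _ hv)
    refine convexHull_min ?_ (convex_segment _ _) (mem_convexHull_maximizers l hV hxP hlxM)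
    rintro v ⟨hv, hlv⟩
    have h1 := sum_mul_le_maxWeight a hv
    have hanti := (mem_realDegreePartitions.1 hv).1
    have h2 := blockFunctional_nonneg a hanti
    rw [hlx] at hlv
    have h3 : ∑ i, a i * v i = maxWeight a := by linarith
    exact mem_segment_of_block_const hu (mem_Icc_of_sum_mul_eq (subset_convexHull ℝ _ hv) h3)
      ((blockFunctional_eq_zero_iff a hanti).1 (by linarith)) h3

/-! ### From edges to endpoint pairs -/

/-- The pairs of endpoints of the edges of the polytope of degree partitions. -/
def edgePairs (n : ℕ) : Set ((Fin n → ℝ) × (Fin n → ℝ)) :=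
  {e | ∃ a : Fin n → ℝ, Antitone a ∧ HasUniqueTie a ∧
    e = (realDegree (tieGraph a ∅), realDegree (tieGraph a Set.univ))}

/-- The endpoints are the least and greatest elements of the segment. -/
lemma segment_injOn_le {E : Type*} [AddCommGroup E] [PartialOrder E] [IsOrderedAddMonoid E]
    [Module ℝ E] [PosSMulMono ℝ E] :
    Set.InjOn (fun e : E × E => segment ℝ e.1 e.2) {e | e.1 ≤ e.2} := by
  rintro ⟨x, y⟩ hxy ⟨z, w⟩ hzw h
  simp only at h
  have hx := segment_subset_Icc hzw (h ▸ left_mem_segment ℝ x y)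
  have hy := segment_subset_Icc hzw (h ▸ right_mem_segment ℝ x y)
  have hz := segment_subset_Icc hxy (h.symm ▸ left_mem_segment ℝ z w)
  have hw := segment_subset_Icc hxy (h.symm ▸ right_mem_segment ℝ z w)
  exact Prod.ext (le_antisymm hz.1 hx.1) (le_antisymm hy.2 hw.2)

lemma ncard_polytopeEdges :
    (polytopeEdges (degreePartitionPolytope n)).ncard = (edgePairs n).ncard := by
  have : polytopeEdges (degreePartitionPolytope n) =
      (fun e : (Fin n → ℝ) × (Fin n → ℝ) => segment ℝ e.1 e.2) '' edgePairs n := by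
    ext F
    constructor
    · intro hF
      obtain ⟨a, ha, hu, rfl⟩ := eq_segment_of_mem_polytopeEdges hF
      exact ⟨_, ⟨a, ha, hu, rfl⟩, rfl⟩
    · rintro ⟨_, ⟨a, ha, hu, rfl⟩, rfl⟩
      exact segment_mem_polytopeEdges ha hu
  rw [this]
  refine Set.InjOn.ncard_image (segment_injOn_le.mono ?_)
  rintro _ ⟨a, -, -, rfl⟩
  have := (isMaxGraph_tieGraph a ∅).mem_Icc
  exact this.2

/-- The absolute values at which the weights `a` have a tie. -/
def tieLevels (a : Fin n → ℝ) : Set ℝ :=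
  {t | ∃ i j, i ≠ j ∧ a i + a j = 0 ∧ |a i| = t}

/-- The pairs of extreme degree vectors for antitone weights whose set of tie levels is in `S`. -/
def thresholdPairs (n : ℕ) (S : Set (Set ℝ)) : Set ((Fin n → ℝ) × (Fin n → ℝ)) :=
  {e | ∃ a : Fin n → ℝ, Antitone a ∧ tieLevels a ∈ S ∧
    e = (realDegree (tieGraph a ∅), realDegree (tieGraph a Set.univ))}

lemma hasUniqueTie_iff (a : Fin n → ℝ) :
    HasUniqueTie a ↔ tieLevels a ∈ Set.range (fun t : ℝ => ({t} : Set ℝ)) := by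
  constructor
  · rintro ⟨i, j, hij, h0, h⟩
    refine ⟨|a i|, Eq.symm ?_⟩
    refine Set.eq_singleton_iff_unique_mem.2 ⟨⟨i, j, hij, h0, rfl⟩, ?_⟩
    rintro _ ⟨k, l, hkl, hk, rfl⟩
    exact h k l hkl hk
  · rintro ⟨t, ht⟩
    obtain ⟨⟨i, j, hij, h0, rfl⟩, h⟩ := Set.eq_singleton_iff_unique_mem.1 ht.symm
    exact ⟨i, j, hij, h0, fun k l hkl hk => h _ ⟨k, l, hkl, hk, rfl⟩⟩

lemma edgePairs_eq (n : ℕ) :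
    edgePairs n = thresholdPairs n (Set.range (fun t : ℝ => ({t} : Set ℝ))) := by
  simp only [edgePairs, thresholdPairs, hasUniqueTie_iff]

lemma finite_thresholdPairs (n : ℕ) (S : Set (Set ℝ)) : (thresholdPairs n S).Finite := by
  refine (Set.finite_range fun G : SimpleGraph (Fin n) × SimpleGraph (Fin n) =>
    (realDegree G.1, realDegree G.2)).subset ?_
  rintro _ ⟨a, -, -, rfl⟩
  exact ⟨(_, _), rfl⟩

lemma realDegree_nonneg (G : SimpleGraph (Fin n)) (i : Fin n) : 0 ≤ realDegree G i := by
  classical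
  exact Finset.sum_nonneg fun j _ => by split_ifs <;> simp

lemma nonneg_of_mem_thresholdPairs {S : Set (Set ℝ)} {e : (Fin n → ℝ) × (Fin n → ℝ)}
    (he : e ∈ thresholdPairs n S) (i : Fin n) : 0 ≤ e.1 i := by
  obtain ⟨a, -, -, rfl⟩ := he
  exact realDegree_nonneg _ _

/-! ### Recursion by removing a dominating or isolated vertex -/

/-- The degree vector after adding a first vertex joined to all others. -/
def dominate (x : Fin n → ℝ) : Fin (n + 1) → ℝ := Fin.cons (n : ℝ) fun i => x i + 1

/-- The degree vector after adding a last, isolated vertex. -/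
def isolate (x : Fin n → ℝ) : Fin (n + 1) → ℝ := Fin.snoc (α := fun _ => ℝ) x 0

lemma dominate_injective : Function.Injective (dominate (n := n)) := by
  intro x y h
  funext i
  simpa [dominate] using congrFun h i.succ

lemma isolate_injective : Function.Injective (isolate (n := n)) := by
  intro x y h
  funext i
  simpa [isolate] using congrFun h i.castSucc

lemma realDegree_tieGraph_dominate {a : Fin (n + 1) → ℝ} (ha : Antitone a)
    (h : 0 < a 0 + a (Fin.last n)) (T : Set ℝ) :
    realDegree (tieGraph a T) = dominate (realDegree (tieGraph (Fin.tail a) T)) := by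
  have hpos : ∀ j, 0 < a 0 + a j := fun j => by linarith [ha (Fin.le_last j)]
  classical
  funext i
  unfold realDegree
  rw [Fin.sum_univ_succ]
  refine Fin.cases ?_ (fun i => ?_) i
  · have h1 : ∀ j : Fin n, (tieGraph a T).Adj 0 j.succ := fun j =>
      ⟨(Fin.succ_ne_zero j).symm, Or.inl (hpos _)⟩
    simp [h1, dominate]
  · have h1 : (tieGraph a T).Adj i.succ 0 :=
      ⟨Fin.succ_ne_zero i, Or.inl (by linarith [hpos i.succ])⟩
    have h2 : ∀ j : Fin n, (tieGraph a T).Adj i.succ j.succ ↔ (tieGraph (Fin.tail a) T).Adj i j :=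
      fun j => by simp [tieGraph, Fin.tail]
    simp only [h1, if_true, dominate, Fin.cons_succ]
    rw [add_comm]
    exact congrArg (· + 1) (Finset.sum_congr rfl fun j _ => if_congr (h2 j) rfl rfl)

lemma realDegree_tieGraph_isolate {a : Fin (n + 1) → ℝ} (ha : Antitone a)
    (h : a 0 + a (Fin.last n) < 0) (T : Set ℝ) :
    realDegree (tieGraph a T) = isolate (realDegree (tieGraph (Fin.init a) T)) := by
  have hneg : ∀ j, a j + a (Fin.last n) < 0 := fun j => by linarith [ha (Fin.zero_le j)]
  have hnot : ∀ j, ¬ (tieGraph a T).Adj j (Fin.last n) := by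
    rintro j ⟨-, h | h⟩ <;> linarith [hneg j]
  classical
  funext i
  unfold realDegree
  rw [Fin.sum_univ_castSucc]
  refine Fin.lastCases ?_ (fun i => ?_) i
  · have h1 : ∀ j : Fin n, ¬ (tieGraph a T).Adj (Fin.last n) j.castSucc := fun j hj =>
      hnot _ hj.symm
    simp [h1, isolate]
  · have h2 : ∀ j : Fin n, (tieGraph a T).Adj i.castSucc j.castSucc ↔
        (tieGraph (Fin.init a) T).Adj i j :=
      fun j => by simp [tieGraph, Fin.init]
    simp only [hnot, if_false, isolate, add_zero, Fin.snoc_castSucc]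
    exact Finset.sum_congr rfl fun j _ => if_congr (h2 j) rfl rfl

lemma tieLevels_tail {a : Fin (n + 1) → ℝ} (ha : Antitone a) (h : 0 < a 0 + a (Fin.last n)) :
    tieLevels a = tieLevels (Fin.tail a) := by
  have hpos : ∀ j, 0 < a 0 + a j := fun j => by linarith [ha (Fin.le_last j)]
  ext t
  constructor
  · rintro ⟨i, j, hij, h0, rfl⟩
    cases i using Fin.cases with
    | zero => linarith [hpos j]
    | succ i =>
      cases j using Fin.cases with
      | zero => linarith [hpos i.succ]
      | succ j => exact ⟨i, j, fun h => hij (by rw [h]), h0, rfl⟩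
  · rintro ⟨i, j, hij, h0, rfl⟩
    exact ⟨i.succ, j.succ, fun h => hij (Fin.succ_injective _ h), h0, rfl⟩

lemma tieLevels_init {a : Fin (n + 1) → ℝ} (ha : Antitone a) (h : a 0 + a (Fin.last n) < 0) :
    tieLevels a = tieLevels (Fin.init a) := by
  have hneg : ∀ j, a j + a (Fin.last n) < 0 := fun j => by linarith [ha (Fin.zero_le j)]
  ext t
  constructor
  · rintro ⟨i, j, hij, h0, rfl⟩
    cases i using Fin.lastCases with
    | last => linarith [hneg j]
    | cast i =>
      cases j using Fin.lastCases with
      | last => linarith [hneg i.castSucc]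
      | cast j => exact ⟨i, j, fun h => hij (by rw [h]), h0, rfl⟩
  · rintro ⟨i, j, hij, h0, rfl⟩
    exact ⟨i.castSucc, j.castSucc, fun h => hij (Fin.castSucc_injective _ h), h0, rfl⟩

lemma exists_forall_abs_lt (a : Fin n → ℝ) : ∃ A : ℝ, 0 < A ∧ ∀ i, |a i| < A := by
  refine ⟨1 + ∑ i, |a i|, ?_, fun i => ?_⟩
  · linarith [Finset.sum_nonneg fun (i : Fin n) (_ : i ∈ Finset.univ) => abs_nonneg (a i)]
  · linarith [Finset.single_le_sum (fun i _ => abs_nonneg (a i)) (Finset.mem_univ i)]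

/-- The pairs of extreme degree vectors whose weights are tied at the outermost level. -/
def outerTiePairs (n : ℕ) (S : Set (Set ℝ)) : Set ((Fin (n + 1) → ℝ) × (Fin (n + 1) → ℝ)) :=
  {e | ∃ a : Fin (n + 1) → ℝ, Antitone a ∧ tieLevels a ∈ S ∧ a 0 + a (Fin.last n) = 0 ∧
    e = (realDegree (tieGraph a ∅), realDegree (tieGraph a Set.univ))}

lemma thresholdPairs_succ (n : ℕ) (S : Set (Set ℝ)) :
    thresholdPairs (n + 1) S = Prod.map dominate dominate '' thresholdPairs n S ∪
      Prod.map isolate isolate '' thresholdPairs n S ∪ outerTiePairs n S := by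
  ext e
  constructor
  · rintro ⟨a, ha, hS, rfl⟩
    rcases lt_trichotomy (a 0 + a (Fin.last n)) 0 with h | h | h
    · refine Or.inl (Or.inr ⟨_, ⟨Fin.init a, fun i j hij => ha (by simpa using hij), ?_, rfl⟩, ?_⟩)
      · rwa [← tieLevels_init ha h]
      · simp only [realDegree_tieGraph_isolate ha h, Prod.map]
    · exact Or.inr ⟨a, ha, hS, h, rfl⟩
    · refine Or.inl (Or.inl ⟨_, ⟨Fin.tail a, fun i j hij => ha (by simpa using hij), ?_, rfl⟩, ?_⟩)
      · rwa [← tieLevels_tail ha h]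
      · simp only [realDegree_tieGraph_dominate ha h, Prod.map]
  · rintro ((⟨_, ⟨a, ha, hS, rfl⟩, rfl⟩ | ⟨_, ⟨a, ha, hS, rfl⟩, rfl⟩) | ⟨a, ha, hS, -, rfl⟩)
    -- A new weight exceeding all absolute values makes the new vertex dominating and creates no
    -- tie; its negative serves for the isolated vertex.
    · obtain ⟨A, hA0, hA⟩ := exists_forall_abs_lt a
      have hb : Antitone (Fin.cons A a : Fin (n + 1) → ℝ) := by
        intro i j hij
        cases j using Fin.cases with
        | zero => rw [Fin.le_zero_iff.1 hij]
        | succ j =>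
          cases i using Fin.cases with
          | zero => simpa using (le_abs_self _).trans (hA j).le
          | succ i => simpa using ha (by simpa using hij)
      have h : 0 < (Fin.cons A a : Fin (n + 1) → ℝ) 0 +
          (Fin.cons A a : Fin (n + 1) → ℝ) (Fin.last n) := by
        cases Fin.last n using Fin.cases with
        | zero => simpa using hA0
        | succ j =>
          simp only [Fin.cons_zero, Fin.cons_succ]
          linarith [neg_abs_le (a j), hA j]
      refine ⟨Fin.cons A a, hb, ?_, ?_⟩
      · rwa [tieLevels_tail hb h, Fin.tail_cons]
      · simp only [realDegree_tieGraph_dominate hb h, Prod.map, Fin.tail_cons]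
    · obtain ⟨A, hA0, hA⟩ := exists_forall_abs_lt a
      set b : Fin (n + 1) → ℝ := Fin.snoc (α := fun _ => ℝ) a (-A) with hbdef
      have hinit : Fin.init b = a := Fin.init_snoc (α := fun _ => ℝ) (-A) a
      have hlast : b (Fin.last n) = -A := Fin.snoc_last (α := fun _ => ℝ) _ _
      have hcast : ∀ i : Fin n, b i.castSucc = a i := fun i =>
        Fin.snoc_castSucc (α := fun _ => ℝ) _ _ _
      have hb : Antitone b := by
        intro i j hij
        cases i using Fin.lastCases with
        | last => rw [Fin.last_le_iff.1 hij]
        | cast i =>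
          cases j using Fin.lastCases with
          | last => rw [hlast, hcast]; linarith [neg_abs_le (a i), hA i]
          | cast j => rw [hcast, hcast]; exact ha (by simpa using hij)
      have h : b 0 + b (Fin.last n) < 0 := by
        rw [hlast]
        cases (0 : Fin (n + 1)) using Fin.lastCases with
        | last => rw [hlast]; linarith
        | cast j => rw [hcast]; linarith [le_abs_self (a j), hA j]
      refine ⟨b, hb, ?_, ?_⟩
      · rwa [tieLevels_init hb h, hinit]
      · simp only [realDegree_tieGraph_isolate hb h, Prod.map, hinit]
    · exact ⟨a, ha, hS, rfl⟩

lemma outerTiePairs_last {S : Set (Set ℝ)} {e : (Fin (n + 2) → ℝ) × (Fin (n + 2) → ℝ)}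
    (he : e ∈ outerTiePairs (n + 1) S) :
    e.1 (Fin.last (n + 1)) = 0 ∧ 0 < e.2 (Fin.last (n + 1)) := by
  obtain ⟨a, ha, -, h0, rfl⟩ := he
  constructor
  · change realDegree _ _ = 0
    unfold realDegree
    refine Finset.sum_eq_zero fun j _ => if_neg ?_
    rintro ⟨-, h | h⟩
    · linarith [ha (Fin.zero_le j)]
    · exact absurd h.2 (by simp)
  · refine lt_of_le_of_lt (realDegree_nonneg (tieGraph a ∅) _)
      (realDegree_tie_lt (j := 0) (by simp [Fin.ext_iff]) (by linarith) (Set.mem_univ _))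

/-- The last coordinates of the two endpoints separate the cases: the lower one is positive after
adding a dominating vertex, both vanish after adding an isolated one, and an outer tie gives zero
then a positive value. The first claim needs a second vertex, whence `n + 2`. -/
lemma ncard_thresholdPairs_succ (n : ℕ) (S : Set (Set ℝ)) :
    (thresholdPairs (n + 2) S).ncard =
      2 * (thresholdPairs (n + 1) S).ncard + (outerTiePairs (n + 1) S).ncard := by
  have hfin := finite_thresholdPairs (n + 2) S
  rw [thresholdPairs_succ] at hfin
  have hf1 := hfin.subset Set.subset_union_left
  have hf2 := hfin.subset Set.subset_union_right
  have hdom : ∀ e ∈ Prod.map dominate dominate '' thresholdPairs (n + 1) S,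
      0 < e.1 (Fin.last (n + 1)) := by
    rintro _ ⟨e, he, rfl⟩
    simp only [Prod.map, dominate, ← Fin.succ_last, Fin.cons_succ]
    linarith [nonneg_of_mem_thresholdPairs he (Fin.last n)]
  have hiso : ∀ e ∈ Prod.map isolate isolate '' thresholdPairs (n + 1) S,
      e.1 (Fin.last (n + 1)) = 0 ∧ e.2 (Fin.last (n + 1)) = 0 := by
    rintro _ ⟨e, he, rfl⟩
    simp [isolate]
  rw [thresholdPairs_succ, Set.ncard_union_eq ?_ hf1 hf2, Set.ncard_union_eq ?_
    (hf1.subset Set.subset_union_left) (hf1.subset Set.subset_union_right),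
    Set.ncard_image_of_injective _ (dominate_injective.prodMap dominate_injective),
    Set.ncard_image_of_injective _ (isolate_injective.prodMap isolate_injective), two_mul]
  · rw [Set.disjoint_left]
    intro e h1 h2
    exact (hdom e h1).ne' (hiso e h2).1
  · rw [Set.disjoint_left]
    rintro e (h1 | h1) h2
    · exact (hdom e h1).ne' (outerTiePairs_last h2).1
    · exact (outerTiePairs_last h2).2.ne' (hiso e h1).2

/-! ### Tie-free weights and base cases -/

lemma realDegree_of_all_ties {a : Fin n → ℝ} (h : ∀ i j, i ≠ j → a i + a j = 0) :
    realDegree (tieGraph a ∅) = (fun _ => 0) ∧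
      realDegree (tieGraph a Set.univ) = fun _ => (n : ℝ) - 1 := by
  classical
  constructor
  · funext i
    unfold realDegree
    refine Finset.sum_eq_zero fun j _ => if_neg ?_
    rintro ⟨hij, h' | h'⟩
    · linarith [h i j hij]
    · exact absurd h'.2 (by simp)
  · funext i
    have : ∀ j, (if (tieGraph a Set.univ).Adj i j then (1 : ℝ) else 0) =
        1 - if i = j then 1 else 0 := by
      intro j
      by_cases hij : i = j
      · simp [hij]
      · have : (tieGraph a Set.univ).Adj i j := ⟨hij, Or.inr ⟨h i j hij, trivial⟩⟩
        simp [this, hij]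
    simp only [realDegree]
    rw [Finset.sum_congr rfl fun j _ => this j]
    simp

/-- The case `n = 0` is needed later for ties with no inner vertices. -/
lemma ncard_thresholdPairs_empty_of_le_one (hn : n ≤ 1) :
    (thresholdPairs n {∅}).ncard = 1 := by
  have hsub : ∀ i j : Fin n, i = j := fun i j => by ext; omega
  rw [Set.ncard_eq_one]
  refine ⟨(fun _ => 0, fun _ => (n : ℝ) - 1), Set.eq_singleton_iff_unique_mem.2 ⟨?_, ?_⟩⟩
  · refine ⟨fun _ => 0, fun _ _ _ => le_rfl, ?_, ?_⟩
    · rw [Set.mem_singleton_iff, Set.eq_empty_iff_forall_notMem]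
      rintro t ⟨i, j, hij, -⟩
      exact hij (hsub i j)
    · have := realDegree_of_all_ties (a := fun _ : Fin n => (0 : ℝ)) fun i j _ => by simp
      rw [this.1, this.2]
  · rintro _ ⟨a, -, -, rfl⟩
    have := realDegree_of_all_ties (a := a) fun i j hij => absurd (hsub i j) hij
    rw [this.1, this.2]

lemma ncard_thresholdPairs_empty (m : ℕ) : (thresholdPairs (m + 1) {∅}).ncard = 2 ^ m := by
  induction m with
  | zero => exact ncard_thresholdPairs_empty_of_le_one le_rfl
  | succ m ih =>
    have : outerTiePairs (m + 1) {∅} = ∅ := by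
      rw [Set.eq_empty_iff_forall_notMem]
      rintro _ ⟨a, -, hS, h0, -⟩
      have : |a 0| ∈ tieLevels a := ⟨0, _, by simp [Fin.ext_iff], h0, rfl⟩
      rw [Set.mem_singleton_iff.1 hS] at this
      exact this
    rw [ncard_thresholdPairs_succ, ih, this, Set.ncard_empty, add_zero, pow_succ, mul_comm]

lemma ncard_edgePairs_two : (edgePairs 2).ncard = 1 := by
  rw [Set.ncard_eq_one]
  refine ⟨(fun _ => 0, fun _ => ((2 : ℕ) : ℝ) - 1), Set.eq_singleton_iff_unique_mem.2 ⟨?_, ?_⟩⟩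
  · refine ⟨fun _ => 0, fun _ _ _ => le_rfl, ⟨0, 1, by simp, by simp, by simp⟩, ?_⟩
    have := realDegree_of_all_ties (a := fun _ : Fin 2 => (0 : ℝ)) fun i j _ => by simp
    rw [this.1, this.2]
  · rintro _ ⟨a, -, ⟨i, j, hij, h0, -⟩, rfl⟩
    -- On two vertices the given tie is the only pair, so all pairs are tied.
    have := realDegree_of_all_ties (a := a) fun k l hkl => by
      have : (k = i ∧ l = j) ∨ (k = j ∧ l = i) := by omega
      rcases this with ⟨rfl, rfl⟩ | ⟨rfl, rfl⟩ <;> linarith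
    rw [this.1, this.2]

/-! ### Block structure of outermost ties -/

section Blocks

variable {p m q : ℕ}

/-- Weights with `p` entries `t`, then the entries of `b`, then `q` entries `-t`. -/
def blockWeights (p q : ℕ) (t : ℝ) (b : Fin m → ℝ) : Fin (p + m + q) → ℝ :=
  Fin.append (Fin.append (fun _ : Fin p => t) b) fun _ : Fin q => -t

/-- The degree vector after adding `p` vertices joined to each other and to all vertices of `x`,
and isolated vertices, with the given extra degrees for the new vertices. -/
noncomputable def tieExtend (n p : ℕ) (x : Fin m → ℝ) (s s' : ℝ) : Fin n → ℝ := fun i =>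
  if (i : ℕ) < p then p + m - 1 + s else if h : (i : ℕ) - p < m then x ⟨i - p, h⟩ + p else s'

lemma blockWeights_top (t : ℝ) (b : Fin m → ℝ) (i : Fin p) :
    blockWeights p q t b (Fin.castAdd q (Fin.castAdd m i)) = t := by
  rw [blockWeights, Fin.append_left, Fin.append_left]

lemma blockWeights_middle (t : ℝ) (b : Fin m → ℝ) (j : Fin m) :
    blockWeights p q t b (Fin.castAdd q (Fin.natAdd p j)) = b j := by
  rw [blockWeights, Fin.append_left, Fin.append_right]

lemma blockWeights_bottom (t : ℝ) (b : Fin m → ℝ) (k : Fin q) :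
    blockWeights p q t b (Fin.natAdd (p + m) k) = -t := by
  rw [blockWeights, Fin.append_right]

lemma realDegree_tieGraph_cast {n' : ℕ} (h : n = n') (a : Fin n' → ℝ) (T : Set ℝ) :
    realDegree (tieGraph (a ∘ Fin.cast h) T) = realDegree (tieGraph a T) ∘ Fin.cast h := by
  subst h
  rfl

lemma tieLevels_cast {n' : ℕ} (h : n = n') (a : Fin n' → ℝ) :
    tieLevels (a ∘ Fin.cast h) = tieLevels a := by
  subst h
  rfl

lemma tieExtend_cast {n' : ℕ} (h : n = n') (x : Fin m → ℝ) (s s' : ℝ) :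
    tieExtend n' p x s s' ∘ Fin.cast h = tieExtend n p x s s' := by
  subst h
  rfl

/-- As inner weights are below `t` in absolute value, top vertices are joined to all top and inner
ones, and bottom vertices to no inner or bottom ones. Only top-bottom pairs depend on `t ∈ T`. -/
lemma realDegree_blockWeights {t : ℝ} (ht : 0 < t) {b : Fin m → ℝ} (hb : ∀ j, |b j| < t)
    (T : Set ℝ) [Decidable (t ∈ T)] :
    realDegree (tieGraph (blockWeights p q t b) T) =
      tieExtend (p + m + q) p (realDegree (tieGraph b T)) (if t ∈ T then q else 0)
        (if t ∈ T then p else 0) := by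
  classical
  set G := tieGraph (blockWeights p q t b) T with hG
  have tt : ∀ i j : Fin p, G.Adj (Fin.castAdd q (Fin.castAdd m i)) (Fin.castAdd q (Fin.castAdd m j)) ↔
      ¬ i = j := fun i j => by
    refine ⟨fun h hij => h.1 (by rw [hij]), fun h => ⟨fun h' => h ?_, Or.inl ?_⟩⟩
    · simpa using h'
    · rw [blockWeights_top, blockWeights_top]; linarith
  have tm : ∀ (i : Fin p) (j : Fin m),
      G.Adj (Fin.castAdd q (Fin.castAdd m i)) (Fin.castAdd q (Fin.natAdd p j)) := fun i j => by
    refine ⟨fun h => ?_, Or.inl ?_⟩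
    · have h1 := congrArg Fin.val h
      simp only [Fin.val_castAdd, Fin.val_natAdd] at h1
      omega
    · rw [blockWeights_top, blockWeights_middle]; linarith [neg_abs_le (b j), hb j]
  have tb : ∀ (i : Fin p) (k : Fin q),
      G.Adj (Fin.castAdd q (Fin.castAdd m i)) (Fin.natAdd (p + m) k) ↔ t ∈ T := fun i k => by
    constructor
    · rintro ⟨-, h | h⟩
      · rw [blockWeights_top, blockWeights_bottom] at h; linarith
      · rw [blockWeights_top, abs_of_pos ht] at h; exact h.2
    · refine fun h => ⟨fun h' => ?_, Or.inr ⟨?_, ?_⟩⟩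
      · have h1 := congrArg Fin.val h'
        simp only [Fin.val_castAdd, Fin.val_natAdd] at h1
        omega
      · rw [blockWeights_top, blockWeights_bottom]; ring
      · rwa [blockWeights_top, abs_of_pos ht]
  have mm : ∀ i j : Fin m, G.Adj (Fin.castAdd q (Fin.natAdd p i)) (Fin.castAdd q (Fin.natAdd p j)) ↔
      (tieGraph b T).Adj i j := fun i j => by
    simp only [hG, tieGraph, blockWeights_middle]
    simp
  have mb : ∀ (i : Fin m) (k : Fin q),
      ¬ G.Adj (Fin.castAdd q (Fin.natAdd p i)) (Fin.natAdd (p + m) k) := fun i k => by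
    rintro ⟨-, h⟩
    rw [blockWeights_middle, blockWeights_bottom] at h
    rcases h with h | h <;> linarith [le_abs_self (b i), hb i]
  have bb : ∀ k l : Fin q, ¬ G.Adj (Fin.natAdd (p + m) k) (Fin.natAdd (p + m) l) := fun k l => by
    rintro ⟨-, h⟩
    rw [blockWeights_bottom, blockWeights_bottom] at h
    rcases h with h | h <;> linarith
  funext i
  unfold realDegree
  rw [Fin.sum_univ_add, Fin.sum_univ_add]
  induction i using Fin.addCases with
  | left i =>
    induction i using Fin.addCases with
    | left i =>
      have h1 : ∀ j : Fin p, (if ¬ i = j then (1 : ℝ) else 0) = 1 - if i = j then 1 else 0 := by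
        intro j; split_ifs <;> simp_all
      have hp : (Fin.castAdd q (Fin.castAdd m i) : ℕ) < p := i.2
      simp only [tt, tm, tb, tieExtend, if_pos hp]
      rw [Finset.sum_congr rfl fun j _ => h1 j]
      by_cases hT : t ∈ T <;> simp [hT] <;> ring
    | right j =>
      have hp : ¬ (Fin.castAdd q (Fin.natAdd p j) : ℕ) < p := by simp
      have hm : (Fin.castAdd q (Fin.natAdd p j) : ℕ) - p < m := by simp
      have hj : (⟨(Fin.castAdd q (Fin.natAdd p j) : ℕ) - p, hm⟩ : Fin m) = j := by ext; simp
      have mt : ∀ i : Fin p,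
          G.Adj (Fin.castAdd q (Fin.natAdd p j)) (Fin.castAdd q (Fin.castAdd m i)) :=
        fun i => (tm i j).symm
      simp only [tieExtend, if_neg hp, dif_pos hm, hj, mt, mb, if_true, if_false,
        Finset.sum_const_zero, add_zero]
      rw [add_comm, Finset.sum_congr rfl fun k _ => if_congr (mm j k) rfl rfl]
      simp
  | right k =>
    have hp : ¬ (Fin.natAdd (p + m) k : ℕ) < p := by simp; omega
    have hm : ¬ (Fin.natAdd (p + m) k : ℕ) - p < m := by simp; omega
    have bt : ∀ i : Fin p,
        G.Adj (Fin.natAdd (p + m) k) (Fin.castAdd q (Fin.castAdd m i)) ↔ t ∈ T :=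
      fun i => by rw [G.adj_comm, tb]
    have bm : ∀ j : Fin m, ¬ G.Adj (Fin.natAdd (p + m) k) (Fin.castAdd q (Fin.natAdd p j)) :=
      fun j h => mb j k h.symm
    simp only [tieExtend, if_neg hp, dif_neg hm, bt, bm, bb, if_false, Finset.sum_const_zero,
      add_zero]
    by_cases hT : t ∈ T <;> simp [hT]

lemma antitone_blockWeights {t : ℝ} (ht : 0 < t) {b : Fin m → ℝ} (hb : ∀ j, |b j| < t)
    (hanti : Antitone b) : Antitone (blockWeights p q t b) := by
  intro i j hij
  unfold blockWeights
  induction i using Fin.addCases with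
  | left i =>
    induction j using Fin.addCases with
    | left j =>
      induction i using Fin.addCases with
      | left i =>
        induction j using Fin.addCases with
        | left j => simp
        | right j => simpa using (le_abs_self _).trans (hb j).le
      | right i =>
        induction j using Fin.addCases with
        | left j =>
          rw [Fin.le_def] at hij
          simp only [Fin.val_castAdd, Fin.val_natAdd] at hij
          omega
        | right j =>
          have h : i ≤ j := by
            rw [Fin.le_def] at hij ⊢
            simpa using hij
          simpa using hanti h
    | right j =>
      induction i using Fin.addCases with
      | left i => simp only [Fin.append_left, Fin.append_right]; linarith
      | right i =>
        simp only [Fin.append_left, Fin.append_right]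
        linarith [neg_abs_le (b i), hb i]
  | right i =>
    induction j using Fin.addCases with
    | left j =>
      rw [Fin.le_def] at hij
      simp only [Fin.val_castAdd, Fin.val_natAdd] at hij
      omega
    | right j => simp

lemma tieLevels_blockWeights {t : ℝ} (ht : 0 < t) {b : Fin m → ℝ} (hp : 0 < p)
    (hq : 0 < q) : tieLevels (blockWeights p q t b) = insert t (tieLevels b) := by
  have habs : ∀ i, |blockWeights p q t b i| = t ∨ ∃ j, i = Fin.castAdd q (Fin.natAdd p j) := fun i => by
    induction i using Fin.addCases with
    | left i =>
      induction i using Fin.addCases with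
      | left i => left; simp [blockWeights, abs_of_pos ht]
      | right j => exact Or.inr ⟨j, rfl⟩
    | right k => left; simp [blockWeights, abs_of_pos ht]
  ext s
  constructor
  · rintro ⟨i, j, hij, h0, rfl⟩
    have hji := congrArg abs (eq_neg_of_add_eq_zero_left h0)
    rw [abs_neg] at hji
    rcases habs i with hi | ⟨i, rfl⟩
    · exact Or.inl hi
    rcases habs j with hj | ⟨j, rfl⟩
    · exact Or.inl (hji.trans hj)
    refine Or.inr ⟨i, j, fun h => hij (by rw [h]), ?_, ?_⟩
    · rwa [blockWeights_middle, blockWeights_middle] at h0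
    · rw [blockWeights_middle]
  · rintro (rfl | ⟨i, j, hij, h0, rfl⟩)
    · refine ⟨Fin.castAdd q (Fin.castAdd m ⟨0, hp⟩), Fin.natAdd (p + m) ⟨0, hq⟩, ?_, ?_, ?_⟩
      · simp [Fin.ext_iff]; omega
      · rw [blockWeights_top, blockWeights_bottom, add_neg_cancel]
      · rw [blockWeights_top, abs_of_pos ht]
    · refine ⟨Fin.castAdd q (Fin.natAdd p i), Fin.castAdd q (Fin.natAdd p j), ?_, ?_, ?_⟩
      · simpa [Fin.ext_iff] using hij
      · rw [blockWeights_middle, blockWeights_middle, h0]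
      · rw [blockWeights_middle]

/-- Inner tie levels lie strictly below `t`, so any of them would be a second level. -/
lemma tieLevels_blockWeights_iff {t : ℝ} (ht : 0 < t) {b : Fin m → ℝ} (hb : ∀ j, |b j| < t)
    (hp : 0 < p) (hq : 0 < q) :
    tieLevels (blockWeights p q t b) ∈ Set.range (fun t : ℝ => ({t} : Set ℝ)) ↔
      tieLevels b = ∅ := by
  rw [tieLevels_blockWeights ht hp hq]
  constructor
  · rintro ⟨s, hs⟩
    rw [Set.eq_empty_iff_forall_notMem]
    intro r hr
    have hs' : insert t (tieLevels b) = {s} := hs.symm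
    have h1 : t ∈ ({s} : Set ℝ) := hs' ▸ Set.mem_insert _ _
    have h2 : r ∈ ({s} : Set ℝ) := hs' ▸ Set.mem_insert_of_mem _ hr
    obtain ⟨i, j, -, -, rfl⟩ := hr
    exact (hb i).ne (Eq.trans h2 h1.symm)
  · intro h
    exact ⟨t, by simp [h]⟩

lemma exists_threshold_of_lower {P : Fin n → Prop} (hP : ∀ i j, i ≤ j → P j → P i) :
    ∃ k ≤ n, ∀ i : Fin n, P i ↔ (i : ℕ) < k := by
  classical
  have hex : ∃ k, ∀ h : k < n, ¬ P ⟨k, h⟩ := ⟨n, fun h => absurd h (lt_irrefl n)⟩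
  refine ⟨Nat.find hex, Nat.find_min' hex fun h => absurd h (lt_irrefl n), fun i => ⟨fun hi => ?_, fun hi => ?_⟩⟩
  · by_contra hcon
    push Not at hcon
    have hlt : Nat.find hex < n := hcon.trans_lt i.2
    exact Nat.find_spec hex hlt (hP ⟨_, hlt⟩ i hcon hi)
  · have := Nat.find_min hex hi
    push Not at this
    exact this.2

lemma exists_eq_blockWeights {a : Fin (n + 1) → ℝ} (ha : Antitone a) (h0 : 0 < a 0)
    (hlast : a 0 + a (Fin.last n) = 0) :
    ∃ p m q, 0 < p ∧ 0 < q ∧ ∃ (h : n + 1 = p + m + q) (b : Fin m → ℝ), Antitone b ∧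
      (∀ j, |b j| < a 0) ∧ a = blockWeights p q (a 0) b ∘ Fin.cast h := by
  -- Here `p` counts the entries equal to the maximum `a 0`, and `k` below counts those above the
  -- minimum `-a 0`; the inner entries lie between.
  obtain ⟨p, hpn, hp⟩ := exists_threshold_of_lower (P := fun i => a 0 ≤ a i)
    fun i j hij h => h.trans (ha hij)
  obtain ⟨k, hkn, hk⟩ := exists_threshold_of_lower (P := fun i => - a 0 < a i)
    fun i j hij h => h.trans_le (ha hij)
  have hp0 : 0 < p := by simpa using (hp 0).1 le_rfl
  have hkn' : k ≤ n := by
    by_contra hcon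
    have := (hk (Fin.last n)).2 (by simp; omega)
    linarith
  have hpk : p ≤ k := by
    by_contra hcon
    have h1 := (hp ⟨k, by omega⟩).2 (by simp; omega)
    have h2 := (hk ⟨k, by omega⟩).not.2 (by simp)
    linarith
  have hN : n + 1 = p + (k - p) + (n + 1 - k) := by omega
  refine ⟨p, k - p, n + 1 - k, hp0, by omega, hN, fun j => a ⟨p + j, by omega⟩, ?_, ?_, ?_⟩
  · intro i j hij
    exact ha (Fin.mk_le_mk.2 (Nat.add_le_add_left hij p))
  · intro j
    have h1 := (hp ⟨p + j, by omega⟩).not.2 (by simp)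
    have h2 := (hk ⟨p + j, by omega⟩).2 (by simp; omega)
    exact abs_lt.2 ⟨h2, not_le.1 h1⟩
  · funext i
    obtain ⟨i, rfl⟩ : ∃ j, i = Fin.cast hN.symm j := ⟨Fin.cast hN i, by simp⟩
    simp only [Function.comp, Fin.cast_cast, Fin.cast_eq_self, blockWeights]
    induction i using Fin.addCases with
    | left i =>
      induction i using Fin.addCases with
      | left i =>
        simp only [Fin.append_left]
        exact le_antisymm (ha (Fin.zero_le _)) ((hp _).2 (by simp))
      | right j =>
        simp only [Fin.append_left, Fin.append_right]
        rfl
    | right j =>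
      simp only [Fin.append_right]
      refine le_antisymm (not_lt.1 ((hk _).not.2 (by simp; omega))) ?_
      linarith [ha (Fin.le_last (Fin.cast hN.symm (Fin.natAdd (p + (k - p)) j)))]

/-- If the outermost level is zero, all weights vanish and every pair is tied. If it is positive, it
uses up the only allowed level, so the inner weights are tie-free. -/
lemma outerTiePairs_eq (n : ℕ) :
    outerTiePairs (n + 1) (Set.range (fun t : ℝ => ({t} : Set ℝ))) =
      insert (fun _ => 0, fun _ => ((n + 2 : ℕ) : ℝ) - 1)
        {e | ∃ p m q, 0 < p ∧ 0 < q ∧ p + m + q = n + 2 ∧ ∃ w ∈ thresholdPairs m {∅},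
          e = (tieExtend (n + 2) p w.1 0 0, tieExtend (n + 2) p w.2 q p)} := by
  ext e
  constructor
  · rintro ⟨a, ha, hS, h0, rfl⟩
    have hle := ha (Fin.zero_le (Fin.last (n + 1)))
    have hnonneg : 0 ≤ a 0 := by linarith
    rcases hnonneg.eq_or_lt with hz | hpos
    · left
      have hall : ∀ i, a i = 0 := fun i =>
        le_antisymm (by linarith [ha (Fin.zero_le i)]) (by linarith [ha (Fin.le_last i)])
      have := realDegree_of_all_ties (a := a) fun i j _ => by rw [hall, hall, add_zero]
      rw [this.1, this.2]
    · right
      obtain ⟨p, m, q, hp, hq, h, b, hb, hlt, hab⟩ := exists_eq_blockWeights ha hpos h0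
      rw [hab, tieLevels_cast h, tieLevels_blockWeights_iff hpos hlt hp hq] at hS
      refine ⟨p, m, q, hp, hq, h.symm, _, ⟨b, hb, hS, rfl⟩, ?_⟩
      classical
      rw [hab]
      simp only [realDegree_tieGraph_cast h, realDegree_blockWeights hpos hlt, tieExtend_cast h]
      simp
  · rintro (rfl | ⟨p, m, q, hp, hq, hN, _, ⟨b, hb, hS, rfl⟩, rfl⟩)
    · refine ⟨fun _ => 0, fun _ _ _ => le_rfl, ⟨0, ?_⟩, by simp, ?_⟩
      · refine Eq.symm (Set.eq_singleton_iff_unique_mem.2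
          ⟨⟨0, Fin.last (n + 1), by simp [Fin.ext_iff], by simp, by simp⟩, ?_⟩)
        · rintro _ ⟨i, j, -, -, rfl⟩
          simp
      · have := realDegree_of_all_ties (a := fun _ : Fin (n + 2) => (0 : ℝ)) fun i j _ => by simp
        rw [this.1, this.2]
    · obtain ⟨t, ht, hlt⟩ := exists_forall_abs_lt b
      classical
      refine ⟨blockWeights p q t b ∘ Fin.cast hN.symm,
        fun i j hij => antitone_blockWeights ht hlt hb (by simpa using hij), ?_, ?_, ?_⟩
      · rw [tieLevels_cast hN.symm]
        exact (tieLevels_blockWeights_iff ht hlt hp hq).2 hS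
      · have h1 : Fin.cast hN.symm 0 = Fin.castAdd q (Fin.castAdd m ⟨0, hp⟩) := by
          ext; simp
        have h2 : Fin.cast hN.symm (Fin.last (n + 1)) =
            Fin.natAdd (p + m) ⟨q - 1, by omega⟩ := by
          ext; simp; omega
        rw [Function.comp_apply, Function.comp_apply, h1, h2, blockWeights_top,
          blockWeights_bottom, add_neg_cancel]
      · simp only [realDegree_tieGraph_cast hN.symm, realDegree_blockWeights ht hlt,
          tieExtend_cast hN.symm]
        simp

end Blocks

/-! ### Counting outermost ties and edges -/

/-- The finite set of pairs of extreme degree vectors for weights without ties. -/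
noncomputable def vertexPairs (m : ℕ) : Finset ((Fin m → ℝ) × (Fin m → ℝ)) :=
  (finite_thresholdPairs m {∅}).toFinset

lemma card_vertexPairs (m : ℕ) : #(vertexPairs m) = 2 ^ (m - 1) := by
  rw [vertexPairs, ← Set.ncard_eq_toFinset_card _ (finite_thresholdPairs m {∅})]
  cases m with
  | zero => exact ncard_thresholdPairs_empty_of_le_one (Nat.zero_le 1)
  | succ m => exact ncard_thresholdPairs_empty m

lemma sum_two_pow_pred (k : ℕ) : ∑ m ∈ range (k + 1), 2 ^ (m - 1) = 2 ^ k := by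
  induction k with
  | zero => rfl
  | succ k ih => rw [sum_range_succ, ih, Nat.add_sub_cancel, pow_succ, mul_two]

/-- Among `k + 2` vertices, `k + 1 - m` is the number of ways to split the `k + 2 - m` outer ones
into two nonempty blocks. Truncated subtraction gives the correct factor `1` at `m = 0`. -/
lemma sum_mul_two_pow_pred (k : ℕ) :
    ∑ m ∈ range (k + 1), (k + 1 - m) * 2 ^ (m - 1) + 1 = 2 ^ (k + 1) := by
  induction k with
  | zero => rfl
  | succ k ih =>
    have h : ∀ m ∈ range (k + 1 + 1), (k + 1 + 1 - m) * 2 ^ (m - 1) =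
        (k + 1 - m) * 2 ^ (m - 1) + 2 ^ (m - 1) := by
      intro m hm
      rw [mem_range] at hm
      rw [show k + 1 + 1 - m = k + 1 - m + 1 by omega, add_mul, one_mul]
    rw [sum_congr rfl h, sum_add_distrib, sum_two_pow_pred, sum_range_succ, Nat.sub_self,
      zero_mul, add_zero, add_right_comm, ih, pow_succ 2 (k + 1), mul_two]

/-- The data of a tie at a nonzero outermost level: the number `m` of inner vertices, one less
than the number of vertices at the positive level, and the pair of inner degree vectors. -/
noncomputable def tieData (n : ℕ) : Finset (Σ m : ℕ, ℕ × ((Fin m → ℝ) × (Fin m → ℝ))) :=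
  (range (n + 1)).sigma fun m => range (n + 1 - m) ×ˢ vertexPairs m

lemma card_tieData (n : ℕ) : #(tieData n) + 1 = 2 ^ (n + 1) := by
  rw [← sum_mul_two_pow_pred, tieData, card_sigma]
  simp only [card_product, card_range, card_vertexPairs]

/-- The pair of extreme degree vectors given by the data of an outermost tie. -/
noncomputable def tiePair (n : ℕ) (d : Σ m : ℕ, ℕ × ((Fin m → ℝ) × (Fin m → ℝ))) :
    (Fin (n + 2) → ℝ) × (Fin (n + 2) → ℝ) :=
  (tieExtend (n + 2) (d.2.1 + 1) d.2.2.1 0 0,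
    tieExtend (n + 2) (d.2.1 + 1) d.2.2.2 ((n + 1 - d.1 - d.2.1 : ℕ) : ℝ) ((d.2.1 + 1 : ℕ) : ℝ))

lemma tieExtend_zero {m p : ℕ} (hp : 0 < p) (x : Fin m → ℝ) (s s' : ℝ) :
    tieExtend (n + 1) p x s s' 0 = p + m - 1 + s := by
  simp [tieExtend, hp]

lemma tieExtend_last {m p : ℕ} (hp : p + m ≤ n) (x : Fin m → ℝ) (s s' : ℝ) :
    tieExtend (n + 1) p x s s' (Fin.last n) = s' := by
  rw [tieExtend, if_neg (by simp; omega), dif_neg (by simp; omega)]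

lemma tieExtend_injective {m p : ℕ} (hp : p + m ≤ n) (s s' : ℝ) :
    Function.Injective fun x : Fin m → ℝ => tieExtend n p x s s' := by
  intro x y h
  funext j
  have := congrFun h ⟨p + j, by omega⟩
  simpa [tieExtend] using this

lemma mem_tieData {m r : ℕ} {w : (Fin m → ℝ) × (Fin m → ℝ)} :
    (⟨m, r, w⟩ : Σ m : ℕ, ℕ × ((Fin m → ℝ) × (Fin m → ℝ))) ∈ tieData n ↔
      m + r ≤ n ∧ w ∈ thresholdPairs m {∅} := by
  simp only [tieData, mem_sigma, mem_range, mem_product, vertexPairs, Set.Finite.mem_toFinset]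
  constructor
  · rintro ⟨h1, h2, h3⟩
    exact ⟨by omega, h3⟩
  · rintro ⟨h1, h2⟩
    exact ⟨by omega, by omega, h2⟩

lemma tiePair_last {m r : ℕ} (h : m + r ≤ n) (w : (Fin m → ℝ) × (Fin m → ℝ)) :
    (tiePair n ⟨m, r, w⟩).2 (Fin.last (n + 1)) = ((r + 1 : ℕ) : ℝ) :=
  tieExtend_last (by simp only; omega) _ _ _

lemma tiePair_zero (m r : ℕ) (w : (Fin m → ℝ) × (Fin m → ℝ)) :
    (tiePair n ⟨m, r, w⟩).2 0 - (tiePair n ⟨m, r, w⟩).1 0 = ((n + 1 - m - r : ℕ) : ℝ) := by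
  simp only [tiePair]
  rw [tieExtend_zero (Nat.succ_pos _), tieExtend_zero (Nat.succ_pos _)]
  ring

/-- The last entry of the upper endpoint is the size of the top block, and the gap between the first
entries is the size of the bottom block. These determine `m`, and then the inner pair is read off.
-/
lemma tiePair_injOn : Set.InjOn (tiePair n) (tieData n : Set _) := by
  rintro ⟨m, r, w⟩ h1 ⟨m', r', w'⟩ h2 h
  rw [mem_coe, mem_tieData] at h1 h2
  have hr := tiePair_last h1.1 w
  rw [h, tiePair_last h2.1 w', Nat.cast_inj] at hr
  obtain rfl : r = r' := by omega
  have hm := tiePair_zero (n := n) m r w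
  rw [h, tiePair_zero, Nat.cast_inj] at hm
  obtain rfl : m = m' := by omega
  obtain ⟨w1, w2⟩ := w
  obtain ⟨w1', w2'⟩ := w'
  have e1 : w1 = w1' := tieExtend_injective (n := n + 2) (p := r + 1) (by omega) _ _
    (congrArg Prod.fst h)
  have e2 : w2 = w2' := tieExtend_injective (n := n + 2) (p := r + 1) (by omega) _ _
    (congrArg Prod.snd h)
  rw [e1, e2]

lemma outerTiePairs_eq_insert_image (n : ℕ) :
    outerTiePairs (n + 1) (Set.range (fun t : ℝ => ({t} : Set ℝ))) =
      insert (fun _ => 0, fun _ => ((n + 2 : ℕ) : ℝ) - 1) (tiePair n '' (tieData n : Set _)) := by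
  rw [outerTiePairs_eq]
  congr 1
  ext e
  constructor
  · rintro ⟨p, m, q, hp, hq, h, w, hw, rfl⟩
    obtain ⟨r, rfl⟩ : ∃ r, p = r + 1 := ⟨p - 1, by omega⟩
    refine ⟨⟨m, r, w⟩, mem_tieData.2 ⟨by omega, hw⟩, ?_⟩
    simp only [tiePair]
    rw [show n + 1 - m - r = q by omega]
  · rintro ⟨⟨m, r, w⟩, hd, rfl⟩
    rw [mem_coe, mem_tieData] at hd
    exact ⟨r + 1, m, n + 1 - m - r, by omega, by omega, by omega, w, hd.2, rfl⟩

lemma ncard_outerTiePairs (n : ℕ) :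
    (outerTiePairs (n + 2) (Set.range (fun t : ℝ => ({t} : Set ℝ)))).ncard = 2 ^ (n + 2) := by
  rw [outerTiePairs_eq_insert_image, Set.ncard_insert_of_notMem ?_
    ((tieData (n + 1)).finite_toSet.image _), tiePair_injOn.ncard_image, Set.ncard_coe_finset,
    card_tieData]
  rintro ⟨⟨m, r, w⟩, hd, h⟩
  rw [mem_coe, mem_tieData] at hd
  have h1 := tiePair_last hd.1 w
  have h2 := tiePair_zero (n := n + 1) m r w
  rw [h] at h1 h2
  -- Coincidence with the zero-weight pair would require both blocks to have size `n + 2`,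
  -- impossible on `n + 3` vertices. On two vertices the coincidence does occur, so the count starts
  -- at three.
  have h3 : n + 3 = r + 2 := by
    have : ((n + 3 : ℕ) : ℝ) = ((r + 2 : ℕ) : ℝ) := by push_cast at h1 ⊢; linarith
    exact_mod_cast this
  have h4 : n + 3 = n + 1 + 1 - m - r + 1 := by
    have : ((n + 3 : ℕ) : ℝ) = ((n + 1 + 1 - m - r + 1 : ℕ) : ℝ) := by
      rw [Nat.cast_succ (n + 1 + 1 - m - r), ← h2]; push_cast; ring
    exact_mod_cast this
  omega

lemma ncard_edgePairs (n : ℕ) : (edgePairs (n + 2)).ncard = 2 ^ n * (2 * n + 1) := by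
  induction n with
  | zero => exact ncard_edgePairs_two
  | succ n ih =>
    rw [edgePairs_eq] at ih ⊢
    rw [ncard_thresholdPairs_succ, ih, ncard_outerTiePairs]
    ring

theorem mainTheorem5 (n : ℕ) (hn : 3 ≤ n) :
    (polytopeEdges (degreePartitionPolytope n)).ncard = 2 ^ (n - 2) * (2 * n - 3) := by
  obtain ⟨k, rfl⟩ : ∃ k, n = k + 2 := ⟨n - 2, by omega⟩
  rw [ncard_polytopeEdges, ncard_edgePairs, Nat.add_sub_cancel,
    show 2 * (k + 2) - 3 = 2 * k + 1 by omega]
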